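/- Games are finite impartial games under the misère play convention (a player who cannot move wins). Write $G=H$ if, for every finite impartial game $X$, the sums $G+X$ and $H+X$ have the same misère outcome; games are considered up to this equality. Options of a game are always options of its simplest form (the form in which no option $G'$ has an option $G''$ equal to $G$, and in which the options are again in simplest form); $G',X',Y'$ denote options of $G,X,Y$. Write $0=\{\}$ and $1=\{0\}$. A game $X$ is a part of $G$ if $G=X+Y$ for some $Y$; such a $Y$ is the counterpart of $X$ in $G$, written $G-X$. Let $\mathbf{Parts}(G)$ be the set of all parts of $G$. Consider the following recursive procedure. It returns a finite set of games together with a record of pairs; ``$X$ and $Y$ are recorded'' means that both are put into $\mathcal X$, each as the counterpart of the other, and $(X',Y')\in\mathcal X$ means that this pair has been recorded. Differences $G'-X$ are looked up in the result of the recursive call on $G'$, and differences $G-X'$ in the current record $\mathcal X$; a difference exists only if it is found there. If $G=0$, return $\{0,1\}$, where $0$ is the counterpart of $0$ and $1$ is the counterpart of $1$. Otherwise: 1. Let $\mathcal X=\emptyset$ and recursively compute $\mathbf{Parts}(G')$ for all options $G'$ of $G$. 2. For every $X$ that lies in $\mathbf{Parts}(G')$ for some $G'$: (a) If $X$ lies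 in every $\mathbf{Parts}(G')$ and every $X'$ lies in $\mathcal X$, let $Y=\{G-X',\,G'-X\}$ (the game whose options are all these differences), and record $X$ and $Y$. (b) Otherwise, if $X\notin\mathbf{Parts}(G')$ for some $G'$, fix any such $G'$ and let $\mathcal Y=\{G'-X' : X' \text{ an option of } X,\ X'\in\mathbf{Parts}(G')\}$; if there is no such $G'$, fix any $X'\notin\mathcal X$ and let $\mathcal Y=\{G'-X' : G' \text{ an option of } G,\ X'\in\mathbf{Parts}(G')\}$. For every $Y\in\mathcal Y$, record $X$ and $Y$ if the following three conditions hold: for all $G'$, either $G'-Y$ is some $X'$ or $G'-X$ is some $Y'$; for all $X'$, either $X'$ is some $G'-Y$ or $(X',Y')\in\mathcal X$ for some $Y'$; for all $Y'$, either $Y'$ is some $G'-X$ or $(X',Y')\in\mathcal X$ for some $X'$. 3. If $\mathcal X$ has changed during step 2, repeat step 2; otherwise return $\mathcal X$. The loops may be run through in any order, and the choices of $G'$ and $X'$ in (b) are arbitrary. **Theorem.** For every finite misère impartial game $G$, every execution of this procedure on $G$ terminates, never gets stuck, and returns exactly the set $\mathbf{Parts}(G)$, together with the counterpart of each part: the recorded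 pairs are exactly the pairs $(X,Y)$ with $G=X+Y$, and for every $X\in\mathbf{Parts}(G)$ there is exactly one such $Y$. -/

import Mathlib

namespace Misere

/-! ### Finite impartial games under the misere play convention -/

/-- A finite impartial game, given by a finite family of options. -/
inductive Game : Type
  | mk (n : ℕ) (f : Fin n → Game) : Game

namespace Game

/-- `K ∈ G`: the game `K` is an option of `G`. -/
protected def Mem : Game → Game → Prop
  | mk _ f, K => ∃ i, f i = K

instance : Membership Game Game := ⟨Game.Mem⟩

theorem mem_mk {n : ℕ} {f : Fin n → Game} {K : Game} : K ∈ mk n f ↔ ∃ i, f i = K := Iff.rfl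

/-- The disjunctive sum: a move is a move in exactly one of the two components. -/
protected noncomputable def add (G H : Game) : Game :=
  Game.rec (motive := fun _ => Game → Game)
    (fun n _ ih H =>
      Game.rec (motive := fun _ => Game)
        (fun m g ihg => mk (n + m) (Fin.addCases (fun i => ih i (mk m g)) ihg)) H) G H

noncomputable instance : Add Game := ⟨Game.add⟩

theorem mem_add {G H K : Game} :
    K ∈ G + H ↔ (∃ A ∈ G, K = A + H) ∨ (∃ B ∈ H, K = G + B) := by
  cases G with
  | mk n f =>
    cases H with
    | mk m g =>
      constructor
      · rintro ⟨i, hi⟩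
        induction i using Fin.addCases with
        | left i =>
          refine Or.inl ⟨f i, ⟨i, rfl⟩, ?_⟩
          rw [← hi]
          exact Fin.addCases_left i
        | right j =>
          refine Or.inr ⟨g j, ⟨j, rfl⟩, ?_⟩
          rw [← hi]
          exact Fin.addCases_right j
      · rintro (⟨A, ⟨i, rfl⟩, rfl⟩ | ⟨B, ⟨j, rfl⟩, rfl⟩)
        · exact ⟨Fin.castAdd m i, Fin.addCases_left i⟩
        · exact ⟨Fin.natAdd n j, Fin.addCases_right j⟩

theorem ind {p : Game → Prop} (h : ∀ G, (∀ K ∈ G, p K) → p G) (G : Game) : p G := by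
  induction G with
  | mk n f ih =>
    refine h _ ?_
    rintro K ⟨i, rfl⟩
    exact ih i

/-- `G` is an N-position of misere play (the player to move wins): either there is no move, so that
the opponent made the last move and loses, or some move leads to a P-position. -/
def IsN : Game → Prop
  | mk n f => n = 0 ∨ ∃ i, ¬ (f i).IsN

theorem isN_iff {G : Game} : G.IsN ↔ (∀ K, K ∉ G) ∨ ∃ K ∈ G, ¬ K.IsN := by
  cases G with
  | mk n f =>
    rw [IsN]
    constructor
    · rintro (rfl | ⟨i, hi⟩)
      · exact Or.inl fun K ⟨i, _⟩ => i.elim0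
      · exact Or.inr ⟨f i, ⟨i, rfl⟩, hi⟩
    · rintro (h | ⟨K, ⟨i, rfl⟩, hK⟩)
      · rcases n with _ | n
        · exact Or.inl rfl
        · exact absurd ⟨0, rfl⟩ (h (f 0))
      · exact Or.inr ⟨i, hK⟩

/-- Misere equality `G = H`: the outcomes of `G + X` and `H + X` agree for every game `X`. -/
def Equal (G H : Game) : Prop := ∀ X : Game, (G + X).IsN ↔ (H + X).IsN

/-- Simplest form: no option is reversible (that is, no option `K` of `G` has an option `L`
equal to `G`), and the options are themselves in simplest form. -/
inductive IsCanonical : Game → Prop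
  | intro (G : Game) (hopt : ∀ K ∈ G, IsCanonical K)
      (hrev : ∀ K ∈ G, ∀ L ∈ K, ¬ Equal L G) : IsCanonical G

/-- Games with the same option trees, up to order and repetition of options; this is used only to
prove that addition respects equality. -/
def Same : Game → Game → Prop
  | mk _ f, mk _ g => (∀ i, ∃ j, Same (f i) (g j)) ∧ ∀ j, ∃ i, Same (f i) (g j)

theorem same_iff {G H : Game} :
    Same G H ↔ (∀ A ∈ G, ∃ B ∈ H, Same A B) ∧ ∀ B ∈ H, ∃ A ∈ G, Same A B := by
  cases G with
  | mk n f =>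
    cases H with
    | mk m g => simp [Same, mem_mk]

theorem Same.intro (G H : Game) (h1 : ∀ A ∈ G, ∃ B ∈ H, Same A B)
    (h2 : ∀ B ∈ H, ∃ A ∈ G, Same A B) : Same G H := same_iff.2 ⟨h1, h2⟩

theorem Same.isN {G H : Game} (h : Same G H) : G.IsN ↔ H.IsN := by
  induction G using ind generalizing H with
  | h G ih =>
    obtain ⟨h1, h2⟩ := same_iff.1 h
    rw [isN_iff (G := G), isN_iff (G := H)]
    constructor
    · rintro (h0 | ⟨A, hA, hn⟩)
      · exact Or.inl fun B hB => let ⟨A, hA, _⟩ := h2 B hB; h0 A hA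
      · obtain ⟨B, hB, hs⟩ := h1 A hA
        exact Or.inr ⟨B, hB, fun h => hn ((ih A hA hs).2 h)⟩
    · rintro (h0 | ⟨B, hB, hn⟩)
      · exact Or.inl fun A hA => let ⟨B, hB, _⟩ := h1 A hA; h0 B hB
      · obtain ⟨A, hA, hs⟩ := h2 B hB
        exact Or.inr ⟨A, hA, fun h => hn ((ih A hA hs).1 h)⟩

theorem same_comm (G H : Game) : Same (G + H) (H + G) := by
  induction G using ind generalizing H with
  | h G ihG =>
    induction H using ind with
    | h H ihH =>
      refine Same.intro _ _ ?_ ?_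
      · intro K hK
        rcases mem_add.1 hK with ⟨A, hA, rfl⟩ | ⟨B, hB, rfl⟩
        · exact ⟨H + A, mem_add.2 (Or.inr ⟨A, hA, rfl⟩), ihG A hA H⟩
        · exact ⟨B + G, mem_add.2 (Or.inl ⟨B, hB, rfl⟩), ihH B hB⟩
      · intro K hK
        rcases mem_add.1 hK with ⟨B, hB, rfl⟩ | ⟨A, hA, rfl⟩
        · exact ⟨G + B, mem_add.2 (Or.inr ⟨B, hB, rfl⟩), ihH B hB⟩
        · exact ⟨A + H, mem_add.2 (Or.inl ⟨A, hA, rfl⟩), ihG A hA H⟩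

theorem Same.add_right {G H : Game} (h : Same G H) (X : Game) : Same (G + X) (H + X) := by
  induction G using ind generalizing H X with
  | h G ihG =>
    induction X using ind with
    | h X ihX =>
      obtain ⟨h1, h2⟩ := same_iff.1 h
      refine Same.intro _ _ ?_ ?_
      · intro K hK
        rcases mem_add.1 hK with ⟨A, hA, rfl⟩ | ⟨Z, hZ, rfl⟩
        · obtain ⟨B, hB, hs⟩ := h1 A hA
          exact ⟨B + X, mem_add.2 (Or.inl ⟨B, hB, rfl⟩), ihG A hA hs X⟩
        · exact ⟨H + Z, mem_add.2 (Or.inr ⟨Z, hZ, rfl⟩), ihX Z hZ⟩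
      · intro K hK
        rcases mem_add.1 hK with ⟨B, hB, rfl⟩ | ⟨Z, hZ, rfl⟩
        · obtain ⟨A, hA, hs⟩ := h2 B hB
          exact ⟨A + X, mem_add.2 (Or.inl ⟨A, hA, rfl⟩), ihG A hA hs X⟩
        · exact ⟨G + Z, mem_add.2 (Or.inr ⟨Z, hZ, rfl⟩), ihX Z hZ⟩

theorem same_assoc (G H X : Game) : Same (G + H + X) (G + (H + X)) := by
  induction G using ind generalizing H X with
  | h G ihG =>
    induction H using ind generalizing X with
    | h H ihH =>
      induction X using ind with
      | h X ihX =>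
        refine Same.intro _ _ ?_ ?_
        · intro K hK
          rcases mem_add.1 hK with ⟨A, hA, rfl⟩ | ⟨Z, hZ, rfl⟩
          · rcases mem_add.1 hA with ⟨B, hB, rfl⟩ | ⟨B, hB, rfl⟩
            · exact ⟨B + (H + X), mem_add.2 (Or.inl ⟨B, hB, rfl⟩), ihG B hB H X⟩
            · exact ⟨G + (B + X), mem_add.2 (Or.inr ⟨_, mem_add.2 (Or.inl ⟨B, hB, rfl⟩), rfl⟩),
                ihH B hB X⟩
          · exact ⟨G + (H + Z), mem_add.2 (Or.inr ⟨_, mem_add.2 (Or.inr ⟨Z, hZ, rfl⟩), rfl⟩),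
              ihX Z hZ⟩
        · intro K hK
          rcases mem_add.1 hK with ⟨B, hB, rfl⟩ | ⟨A, hA, rfl⟩
          · exact ⟨B + H + X, mem_add.2 (Or.inl ⟨_, mem_add.2 (Or.inl ⟨B, hB, rfl⟩), rfl⟩),
              ihG B hB H X⟩
          · rcases mem_add.1 hA with ⟨B, hB, rfl⟩ | ⟨Z, hZ, rfl⟩
            · exact ⟨G + B + X, mem_add.2 (Or.inl ⟨_, mem_add.2 (Or.inr ⟨B, hB, rfl⟩), rfl⟩),
                ihH B hB X⟩
            · exact ⟨G + H + Z, mem_add.2 (Or.inr ⟨Z, hZ, rfl⟩), ihX Z hZ⟩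

theorem Equal.add_right {G H : Game} (h : Equal G H) (K : Game) : Equal (G + K) (H + K) :=
  fun X => ((same_assoc G K X).isN.trans (h (K + X))).trans (same_assoc H K X).isN.symm

theorem equal_comm (G H : Game) : Equal (G + H) (H + G) :=
  fun X => ((same_comm G H).add_right X).isN

theorem equal_equivalence : Equivalence Equal where
  refl _ _ := Iff.rfl
  symm h X := (h X).symm
  trans h h1 X := (h X).trans (h1 X)

theorem Equal.add {G H A B : Game} (h : Equal G H) (h1 : Equal A B) : Equal (G + A) (H + B) :=
  equal_equivalence.trans (h.add_right A) <|
    equal_equivalence.trans (equal_comm H A) <|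
      equal_equivalence.trans (h1.add_right H) (equal_comm B H)

instance setoid : Setoid Game := ⟨Equal, equal_equivalence⟩

end Game

/-- The monoid of misere impartial game values: games modulo misere equality. -/
def Value : Type := Quotient Game.setoid

/-- The value of a game. -/
def Game.value (G : Game) : Value := Quotient.mk Game.setoid G

namespace Value

noncomputable instance : Add Value :=
  ⟨Quotient.map₂ (· + ·) fun _ _ h _ _ h1 => Game.Equal.add h h1⟩

/-- The game `0`, without options. -/
instance : Zero Value := ⟨(Game.mk 0 Fin.elim0).value⟩

/-- The game `1`, whose only option is `0`. -/
instance : One Value := ⟨(Game.mk 1 fun _ => Game.mk 0 Fin.elim0).value⟩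

theorem value_add (G H : Game) : (G + H).value = G.value + H.value := rfl

theorem value_eq_iff {G H : Game} : G.value = H.value ↔ G.Equal H :=
  ⟨fun h => Quotient.exact h, fun h => Quotient.sound h⟩

/-- The options of the simplest form of `v`. -/
def options (v : Value) : Set Value :=
  {w | ∃ G : Game, G.IsCanonical ∧ G.value = v ∧ ∃ K ∈ G, K.value = w}

/-- `Y` is the value of the game `{s : s ∈ S}`. -/
def IsGameOf (S : Set Value) (Y : Value) : Prop :=
  ∃ K : Game, K.value = Y ∧ {w | ∃ L ∈ K, L.value = w} = S

/-- The parts of `G`: the games `X` such that `G = X + Y` for some `Y`. -/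
def parts (G : Value) : Set Value := {X | ∃ Y, G = X + Y}

end Value

/-! ### The algorithm -/

/-- A record of parts together with their counterparts: a finite set of pairs `(X, Y)`,
where `Y` is the counterpart of `X`. -/
abbrev Table : Type := Finset (Value × Value)

/-- `X` occurs in the table `T` (as the first entry of a pair). -/
def Table.Has (T : Table) (X : Value) : Prop := ∃ Y, (X, Y) ∈ T

open Classical in
/-- `T ∪ {X, Y}`, recording that `X` and `Y` are counterparts of each other. -/
noncomputable def Table.record (T : Table) (X Y : Value) : Table := T ∪ {(X, Y), (Y, X)}

open Classical in
/-- The known parts of `0`, with their counterparts: `0 = 0 + 0` and `0 = 1 + 1`. -/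
noncomputable def Table.zero : Table := {(0, 0), (1, 1)}

/-- The list `l` runs through the elements of `S`, in some order, each element once. -/
def Enumerates {α : Type} (l : List α) (S : Set α) : Prop := l.Nodup ∧ ∀ x, x ∈ l ↔ x ∈ S

/-- The candidates of the main loop: everything that is listed as a part of some option of `G`.
Here and below, `tabs` is the list of the tables computed for the options of `G`. -/
def candidates (tabs : List Table) : Set Value := {X | ∃ T ∈ tabs, T.Has X}

/-- Every option of `G` has `X` among its parts, and every option of `X` is already recorded. -/
def NovelTest (tabs : List Table) (R : Table) (X : Value) : Prop :=
  (∀ T ∈ tabs, T.Has X) ∧ ∀ x ∈ X.options, R.Has x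

/-- The differences `G - x`, with `x` an option of `X`, and `g - X`, with `g` an option of `G`,
looked up in the tables. -/
def novelOptions (tabs : List Table) (R : Table) (X : Value) : Set Value :=
  {z | (∃ x ∈ X.options, (x, z) ∈ R) ∨ ∃ T ∈ tabs, (X, z) ∈ T}

/-- The differences `g - x`, with `g` a fixed option of `G`, whose table is `T`, and `x` an option
of `X` that is a part of `g`. -/
def differencesAt (T : Table) (X : Value) : Set Value := {z | ∃ x ∈ X.options, (x, z) ∈ T}

/-- The differences `g - x`, with `x` fixed and `g` an option of `G` of which `x` is a part. -/
def differencesOf (tabs : List Table) (x : Value) : Set Value := {z | ∃ T ∈ tabs, (x, z) ∈ T}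

/-- The condition under which `X` and `Y` are recorded as a derived partition. In the three clauses
`g`, `x`, `y` stand for options of `G`, `X`, `Y`:
for all `g`, either `g - Y` is some `x` or `g - X` is some `y`;
for all `x`, either some `g - Y` is `x` or some `(x, y)` is recorded;
for all `y`, either some `g - X` is `y` or some `(x, y)` is recorded. -/
def DerivedTest (tabs : List Table) (R : Table) (X Y : Value) : Prop :=
  (∀ T ∈ tabs, (∃ x ∈ X.options, (Y, x) ∈ T) ∨ ∃ y ∈ Y.options, (X, y) ∈ T) ∧
  (∀ x ∈ X.options, (∃ T ∈ tabs, (Y, x) ∈ T) ∨ ∃ y ∈ Y.options, (x, y) ∈ R) ∧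
  (∀ y ∈ Y.options, (∃ T ∈ tabs, (X, y) ∈ T) ∨ ∃ x ∈ X.options, (x, y) ∈ R)

/-- A suspended call: it has computed the tables `tabs`, waits for the table of one more option,
and has the options in `pending` still to treat. -/
structure Frame : Type where
  pending : List Value
  tabs : List Table

/-- The states of the algorithm; `st` is the stack of suspended calls. -/
inductive State : Type
  /-- The procedure is called on `G`. -/
  | call (G : Value) (st : List Frame)
  /-- The loop over the options of `G` that makes the recursive calls. -/
  | collect (pending : List Value) (tabs : List Table) (st : List Frame)
  /-- The main loop: `R₀` is the record at the start of the current pass, `R` is the present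
  record, `todo` holds the candidates that the pass has still to treat. -/
  | scan (tabs : List Table) (R₀ R : Table) (todo : List Value) (st : List Frame)
  /-- The inner loop for the candidate `X`, with the games in `ys` still to treat. -/
  | test (tabs : List Table) (R₀ R : Table) (todo : List Value) (X : Value) (ys : List Value)
      (st : List Frame)
  /-- The current call returns the table `P`. -/
  | ret (P : Table) (st : List Frame)

/-- One step of the algorithm. It is nondeterministic: the loops may run through their ranges in any
order, and wherever an element has to be fixed, any admissible one may be taken. -/
inductive Step : State → State → Prop
  /-- Base case. -/
  | base (st : List Frame) : Step (.call 0 st) (.ret Table.zero st)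
  | enter (G : Value) (pending : List Value) (st : List Frame) (h0 : G ≠ 0)
      (hl : Enumerates pending G.options) :
      Step (.call G st) (.collect pending [] st)
  /-- A recursive call. -/
  | recurse (g : Value) (pending : List Value) (tabs : List Table) (st : List Frame) :
      Step (.collect (g :: pending) tabs st) (.call g (⟨pending, tabs⟩ :: st))
  /-- Return from a recursive call. -/
  | resume (P : Table) (pending : List Value) (tabs : List Table) (st : List Frame) :
      Step (.ret P (⟨pending, tabs⟩ :: st)) (.collect pending (P :: tabs) st)
  /-- All recursive calls are done: start the main loop with an empty record. -/
  | start (tabs : List Table) (todo : List Value) (st : List Frame)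
      (hl : Enumerates todo (candidates tabs)) :
      Step (.collect [] tabs st) (.scan tabs ∅ ∅ todo st)
  /-- The candidate `X` passes the novelty test: record `X` and `Y`. -/
  | novel (tabs : List Table) (R₀ R : Table) (X Y : Value) (todo : List Value) (st : List Frame)
      (hX : NovelTest tabs R X) (hY : Value.IsGameOf (novelOptions tabs R X) Y) :
      Step (.scan tabs R₀ R (X :: todo) st) (.scan tabs R₀ (R.record X Y) todo st)
  /-- `X` is not a part of some option of `G`: fix any such option (with table `T`). -/
  | fixOption (tabs : List Table) (R₀ R : Table) (X : Value) (todo : List Value) (st : List Frame)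
      (T : Table) (hT : T ∈ tabs) (hX : ¬ T.Has X) (ys : List Value)
      (hl : Enumerates ys (differencesAt T X)) :
      Step (.scan tabs R₀ R (X :: todo) st) (.test tabs R₀ R todo X ys st)
  /-- `X` is a part of every option of `G`, but some option of `X` is not recorded: fix any such
  option `x`. -/
  | fixPart (tabs : List Table) (R₀ R : Table) (X : Value) (todo : List Value) (st : List Frame)
      (hX : ∀ T ∈ tabs, T.Has X) (x : Value) (hx : x ∈ X.options) (hR : ¬ R.Has x)
      (ys : List Value) (hl : Enumerates ys (differencesOf tabs x)) :
      Step (.scan tabs R₀ R (X :: todo) st) (.test tabs R₀ R todo X ys st)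
  /-- `Y` passes the test of the inner loop: record `X` and `Y`. -/
  | accept (tabs : List Table) (R₀ R : Table) (X Y : Value) (ys todo : List Value)
      (st : List Frame) (h : DerivedTest tabs R X Y) :
      Step (.test tabs R₀ R todo X (Y :: ys) st) (.test tabs R₀ (R.record X Y) todo X ys st)
  | reject (tabs : List Table) (R₀ R : Table) (X Y : Value) (ys todo : List Value)
      (st : List Frame) (h : ¬ DerivedTest tabs R X Y) :
      Step (.test tabs R₀ R todo X (Y :: ys) st) (.test tabs R₀ R todo X ys st)
  /-- The inner loop is done: go on with the next candidate. -/
  | next (tabs : List Table) (R₀ R : Table) (X : Value) (todo : List Value) (st : List Frame) :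
      Step (.test tabs R₀ R todo X [] st) (.scan tabs R₀ R todo st)
  /-- The record has changed during the pass: run the main loop again. -/
  | again (tabs : List Table) (R₀ R : Table) (todo : List Value) (st : List Frame) (h : R ≠ R₀)
      (hl : Enumerates todo (candidates tabs)) :
      Step (.scan tabs R₀ R [] st) (.scan tabs R R todo st)
  /-- The record has not changed during the pass: return it. -/
  | finish (tabs : List Table) (R : Table) (st : List Frame) :
      Step (.scan tabs R R [] st) (.ret R st)

end Misere

/-!
The procedure is correct because the monoid of misère values is cancellative, and because equality
of a game with a sum can be read off from options.

*Equality.* Two games are *linked* if some game makes a P-position together with either of them.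
They are linked unless one of them is an option of the other (`linked_iff`); this holds for
arbitrary forms of both. Two games that are not `0` are equal if neither is linked to an option of
the other (`eq_of_not_linked`), and no game is linked to its own options. So the options of the
simplest form of `G = X + Y` are among the games `x + Y`, `X + y`, and the other games of this kind
have `G` as an option.

*Cancellation* (`cancellable`). Suppose `G + T = H + T`, and that the followers of `T` can be
cancelled. If `h` is an option of `H`, then `h + T` is not linked to `G + T`. Either this gives by
induction that `h` is not linked to `G`, or it gives a crossed equation `h + T = G + t` or
`h + t = G + T` with an option `t` of `T`, which is passed on down the options of `T` until it
breaks off (`not_linked_of_crossed`). The remaining case is that one of `G` and `H` is `0`, where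
the equation `H + T = T` has to imply that `H` is an N-position (`isN_of_add_eq_self`). This uses
that the only partitions of `0` are `0 + 0` and `1 + 1` (`zero_eq_add_iff`).

*The procedure.* The criterion for equality makes every recorded pair a partition of `G`
(`IsOptionTables.eq_add_of_novelTest`, `IsOptionTables.eq_add_of_derivedTest`). Conversely, by
cancellation an option `x + Y` of `X + Y` that reverses to `G` does so through some `x + y`. So if
all partitions of `G` into an option of `X` and an option of `Y` are recorded, the pair `X`, `Y`
passes the test, and `Y` is among the games that are tested with `X`. A pass of the main loop that
changes nothing therefore finds all partitions, by induction
(`IsRecord.isPartitionTable`). Since the summand `X` determines `Y`, there are only finitely many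
partitions, and the record cannot grow forever (`Settles.scan`).
-/

namespace Misere

open Set

/-! ### Forms of values, sums and outcomes -/

namespace Game

theorem exists_forall_mem_iff {S : Set Game} (hS : S.Finite) : ∃ K : Game, ∀ L, L ∈ K ↔ L ∈ S := by
  obtain ⟨n, f, hf⟩ := hS.fin_embedding
  refine ⟨mk n f, fun L => ?_⟩
  rw [mem_mk, ← hf]
  rfl

theorem finite_setOf_mem (G : Game) : {K | K ∈ G}.Finite := by
  cases G with
  | mk n f => exact finite_range f

theorem not_mem_zero (K : Game) : K ∉ mk 0 Fin.elim0 := fun ⟨i, _⟩ => i.elim0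

theorem same_add_zero (G : Game) : Same (G + mk 0 Fin.elim0) G := by
  induction G using ind with
  | h G ih =>
    refine Same.intro _ _ ?_ fun B hB => ⟨_, mem_add.2 (Or.inl ⟨B, hB, rfl⟩), ih B hB⟩
    intro A hA
    rcases mem_add.1 hA with ⟨B, hB, rfl⟩ | ⟨B, hB, rfl⟩
    · exact ⟨B, hB, ih B hB⟩
    · exact absurd hB (not_mem_zero B)

theorem Equal.isN_iff {G H : Game} (h : Equal G H) : G.IsN ↔ H.IsN :=
  ((same_add_zero G).isN.symm.trans (h _)).trans (same_add_zero H).isN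

end Game

namespace Value

noncomputable instance : AddCommMonoid Value where
  add_assoc a b c := by
    induction a using Quotient.inductionOn
    induction b using Quotient.inductionOn
    induction c using Quotient.inductionOn
    exact Quotient.sound fun X => ((Game.same_assoc _ _ _).add_right X).isN
  add_comm a b := by
    induction a using Quotient.inductionOn
    induction b using Quotient.inductionOn
    exact Quotient.sound (Game.equal_comm _ _)
  zero_add a := by
    induction a using Quotient.inductionOn with
    | h G => exact Quotient.sound fun X =>
        ((Game.same_comm _ _).add_right X).isN.trans ((Game.same_add_zero G).add_right X).isN
  add_zero a := by
    induction a using Quotient.inductionOn with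
    | h G => exact Quotient.sound fun X => ((Game.same_add_zero G).add_right X).isN
  nsmul := nsmulRec

/-- The misère outcome of a value: the player to move wins. -/
def IsN (v : Value) : Prop :=
  Quotient.lift Game.IsN (fun _ _ h => propext (Game.Equal.isN_iff h)) v

theorem exists_value_eq (V : Value) : ∃ G : Game, G.value = V := Quotient.exists_rep V

theorem isGameOf_value (G : Game) : IsGameOf {w | ∃ L ∈ G, L.value = w} G.value := ⟨G, rfl, rfl⟩

theorem exists_isGameOf (V : Value) : ∃ S, IsGameOf S V := by
  obtain ⟨G, rfl⟩ := exists_value_eq V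
  exact ⟨_, isGameOf_value G⟩

theorem IsGameOf.finite {S : Set Value} {V : Value} (h : IsGameOf S V) : S.Finite := by
  obtain ⟨G, -, rfl⟩ := h
  exact (G.finite_setOf_mem).image Game.value

theorem exists_isGameOf_of_finite {S : Set Value} (hS : S.Finite) : ∃ V, IsGameOf S V := by
  choose f hf using exists_value_eq
  obtain ⟨K, hK⟩ := Game.exists_forall_mem_iff (hS.image f)
  refine ⟨K.value, K, rfl, Set.ext fun w => ⟨?_, fun hw => ⟨f w, (hK _).2 ⟨w, hw, rfl⟩, hf w⟩⟩⟩
  rintro ⟨L, hL, rfl⟩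
  obtain ⟨v, hv, rfl⟩ := (hK L).1 hL
  rwa [hf v]

/-- Induction on values along the options of one arbitrary form of each value. -/
theorem form_induction {p : Value → Prop}
    (h : ∀ S V, IsGameOf S V → (∀ s ∈ S, p s) → p V) (V : Value) : p V := by
  obtain ⟨G, rfl⟩ := exists_value_eq V
  induction G using Game.ind with
  | h G ih =>
    refine h _ _ (isGameOf_value G) ?_
    rintro _ ⟨L, hL, rfl⟩
    exact ih L hL

theorem isGameOf_zero : IsGameOf ∅ 0 :=
  ⟨_, rfl, Set.ext fun _ => ⟨fun ⟨L, hL, _⟩ => Game.not_mem_zero L hL, fun h => h.elim⟩⟩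

theorem isGameOf_one : IsGameOf {0} 1 :=
  ⟨_, rfl, Set.ext fun _ => ⟨fun ⟨_, ⟨_, hi⟩, hL⟩ => by rw [← hL, ← hi]; rfl,
    fun h => ⟨_, ⟨0, rfl⟩, h.symm⟩⟩⟩

theorem IsGameOf.isN_iff {S : Set Value} {V : Value} (h : IsGameOf S V) :
    V.IsN ↔ S = ∅ ∨ ∃ s ∈ S, ¬ s.IsN := by
  obtain ⟨G, rfl, rfl⟩ := h
  refine Game.isN_iff.trans (or_congr ?_ ?_)
  · simp [Set.eq_empty_iff_forall_notMem]
  · constructor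
    · rintro ⟨K, hK, h⟩
      exact ⟨_, ⟨K, hK, rfl⟩, h⟩
    · rintro ⟨_, ⟨K, hK, rfl⟩, h⟩
      exact ⟨K, hK, h⟩

theorem IsGameOf.add {S T : Set Value} {V W : Value} (hS : IsGameOf S V) (hT : IsGameOf T W) :
    IsGameOf ((· + W) '' S ∪ (V + ·) '' T) (V + W) := by
  obtain ⟨G, rfl, rfl⟩ := hS
  obtain ⟨H, rfl, rfl⟩ := hT
  refine ⟨G + H, rfl, Set.ext fun w => ?_⟩
  constructor
  · rintro ⟨L, hL, rfl⟩
    rcases Game.mem_add.1 hL with ⟨A, hA, rfl⟩ | ⟨A, hA, rfl⟩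
    · exact Or.inl ⟨_, ⟨A, hA, rfl⟩, rfl⟩
    · exact Or.inr ⟨_, ⟨A, hA, rfl⟩, rfl⟩
  · rintro (⟨_, ⟨A, hA, rfl⟩, rfl⟩ | ⟨_, ⟨A, hA, rfl⟩, rfl⟩)
    · exact ⟨_, Game.mem_add.2 (Or.inl ⟨A, hA, rfl⟩), rfl⟩
    · exact ⟨_, Game.mem_add.2 (Or.inr ⟨A, hA, rfl⟩), rfl⟩

theorem isN_add_iff {S T : Set Value} {V W : Value} (hS : IsGameOf S V) (hT : IsGameOf T W) :
    (V + W).IsN ↔ (S = ∅ ∧ T = ∅) ∨ (∃ s ∈ S, ¬ (s + W).IsN) ∨ ∃ t ∈ T, ¬ (V + t).IsN := by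
  rw [(hS.add hT).isN_iff]
  simp only [union_empty_iff, image_eq_empty, mem_union, mem_image, or_and_right, exists_or,
    exists_exists_and_eq_and]

theorem isN_add_of_left {S : Set Value} {V s : Value} (hS : IsGameOf S V) (hs : s ∈ S) (W : Value)
    (h : ¬ (s + W).IsN) : (V + W).IsN := by
  obtain ⟨T, hT⟩ := exists_isGameOf W
  exact (isN_add_iff hS hT).2 (Or.inr (Or.inl ⟨s, hs, h⟩))

theorem isN_add_of_right {T : Set Value} {W t : Value} (hT : IsGameOf T W) (ht : t ∈ T) (V : Value)
    (h : ¬ (V + t).IsN) : (V + W).IsN := by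
  rw [add_comm] at h ⊢
  exact isN_add_of_left hT ht V h

theorem ext_isN {V W : Value} (h : ∀ X : Value, (V + X).IsN ↔ (W + X).IsN) : V = W := by
  obtain ⟨G, rfl⟩ := exists_value_eq V
  obtain ⟨H, rfl⟩ := exists_value_eq W
  exact value_eq_iff.2 fun X => h X.value

theorem IsGameOf.unique {S : Set Value} {V W : Value} (hV : IsGameOf S V) (hW : IsGameOf S W) :
    V = W := by
  refine ext_isN fun X => ?_
  induction X using form_induction with
  | h T X hT ih =>
    rw [isN_add_iff hV hT, isN_add_iff hW hT]
    refine or_congr_right (or_congr_right (exists_congr fun t => and_congr_right fun ht => ?_))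
    rw [ih t ht]

/-- If an option of an option of `K` equals `K`, it is itself a simplest form of `K`, so that
simplest forms exist without any need to delete reversible options. -/
theorem exists_isCanonical (V : Value) : ∃ K : Game, K.IsCanonical ∧ K.value = V := by
  induction V using form_induction with
  | h S V hS ih =>
    have : Nonempty Game := ⟨.mk 0 Fin.elim0⟩
    choose! f hf hfv using ih
    obtain ⟨K, hK⟩ := Game.exists_forall_mem_iff (hS.finite.image f)
    have hKS : IsGameOf S K.value := by
      refine ⟨K, rfl, Set.ext fun w => ⟨?_, fun hw => ⟨f w, (hK _).2 ⟨w, hw, rfl⟩, hfv w hw⟩⟩⟩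
      rintro ⟨L, hL, rfl⟩
      obtain ⟨v, hv, rfl⟩ := (hK L).1 hL
      rwa [hfv v hv]
    have hKV : K.value = V := hKS.unique hS
    have hcan : ∀ L ∈ K, L.IsCanonical := by
      intro L hL
      obtain ⟨v, hv, rfl⟩ := (hK L).1 hL
      exact hf v hv
    by_cases hrev : ∃ L ∈ K, ∃ M ∈ L, Game.Equal M K
    · obtain ⟨L, hL, M, hM, hMK⟩ := hrev
      refine ⟨M, ?_, (value_eq_iff.2 hMK).trans hKV⟩
      cases hcan L hL with
      | intro _ h _ => exact h M hM
    · exact ⟨K, .intro K hcan fun L hL M hM h => hrev ⟨L, hL, M, hM, h⟩, hKV⟩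

/-! ### Linked games and equality -/

theorem IsGameOf.not_isN_iff {S : Set Value} {V : Value} (h : IsGameOf S V) :
    ¬ V.IsN ↔ S.Nonempty ∧ ∀ s ∈ S, s.IsN := by
  rw [h.isN_iff, not_or, ← ne_eq, ← nonempty_iff_ne_empty]
  push Not
  rfl

/-- A P-position `V + M` is reached from `V ≠ 0` by letting the options of `M` be such partners of
the options of `V`; for `V = 0` take `M = 1`. -/
theorem exists_not_isN_add (V : Value) : ∃ M : Value, ¬ (V + M).IsN := by
  induction V using form_induction with
  | h S V hS ih =>
    choose! f hf using ih
    rcases S.eq_empty_or_nonempty with rfl | hne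
    · refine ⟨1, ?_⟩
      rw [hS.unique isGameOf_zero, zero_add, isGameOf_one.not_isN_iff]
      refine ⟨singleton_nonempty _, ?_⟩
      rintro _ rfl
      exact isGameOf_zero.isN_iff.2 (Or.inl rfl)
    · obtain ⟨M, hM⟩ := exists_isGameOf_of_finite (hS.finite.image f)
      refine ⟨M, (hS.add hM).not_isN_iff.2 ⟨(hne.image _).inl, ?_⟩⟩
      rintro _ (⟨s, hs, rfl⟩ | ⟨_, ⟨s, hs, rfl⟩, rfl⟩)
      · exact isN_add_of_right hM (mem_image_of_mem f hs) s (hf s hs)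
      · exact isN_add_of_left hS hs _ (hf s hs)

/-- The roles of two distinguishable games can be exchanged: with `T` and partners of the options
of `W` as its options, `U` makes `W + U` a P-position, while `V + U` has the option `V + T`. -/
theorem exists_separator_of_separator {V W T : Value} (hV : ¬ (V + T).IsN) (hW : (W + T).IsN) :
    ∃ U : Value, (V + U).IsN ∧ ¬ (W + U).IsN := by
  obtain ⟨S, hS⟩ := exists_isGameOf W
  choose f hf using exists_not_isN_add
  obtain ⟨U, hU⟩ := exists_isGameOf_of_finite ((hS.finite.image f).insert T)
  refine ⟨U, isN_add_of_right hU (mem_insert _ _) V hV,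
    (hS.add hU).not_isN_iff.2 ⟨((insert_nonempty _ _).image _).inr, ?_⟩⟩
  rintro _ (⟨s, hs, rfl⟩ | ⟨_, rfl | ⟨s, hs, rfl⟩, rfl⟩)
  · exact isN_add_of_right hU (mem_insert_of_mem _ (mem_image_of_mem f hs)) s (hf s)
  · exact hW
  · exact isN_add_of_left hS hs _ (hf s)

theorem exists_separator {V W : Value} (h : V ≠ W) : ∃ T : Value, ¬ (V + T).IsN ∧ (W + T).IsN := by
  by_contra! hT
  refine h (ext_isN fun X => ⟨fun hV => ?_, fun hW => ?_⟩)
  · by_contra hW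
    obtain ⟨U, hU, hU'⟩ := exists_separator_of_separator hW hV
    exact hT U ‹_› ‹_›
  · by_contra hV
    exact hT X hV hW

/-- `V` and `W` are linked if some game makes a P-position together with either of them. -/
def Linked (V W : Value) : Prop := ∃ T : Value, ¬ (V + T).IsN ∧ ¬ (W + T).IsN

theorem Linked.symm {V W : Value} (h : Linked V W) : Linked W V :=
  let ⟨T, h1, h2⟩ := h
  ⟨T, h2, h1⟩

/-- Two games are linked unless one of them is an option of the other: a linking game has as options
games that separate `V` from the options of `W` and `W` from the options of `V`. -/
theorem linked_iff {S T : Set Value} {V W : Value} (hS : IsGameOf S V) (hT : IsGameOf T W) :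
    Linked V W ↔ W ∉ S ∧ V ∉ T := by
  constructor
  · rintro ⟨X, hV, hW⟩
    exact ⟨fun h => hV (isN_add_of_left hS h X hW), fun h => hW (isN_add_of_left hT h X hV)⟩
  · rintro ⟨hWS, hVT⟩
    have h1 : ∀ s ∈ S, ∃ X : Value, ¬ (s + X).IsN ∧ (W + X).IsN :=
      fun s hs => exists_separator fun h => hWS (h ▸ hs)
    have h2 : ∀ t ∈ T, ∃ X : Value, ¬ (t + X).IsN ∧ (V + X).IsN :=
      fun t ht => exists_separator fun h => hVT (h ▸ ht)
    choose! f hf hf' using h1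
    choose! g hg hg' using h2
    rcases (S ∪ T).eq_empty_or_nonempty with he | hne
    · obtain ⟨rfl, rfl⟩ := union_empty_iff.1 he
      obtain ⟨M, hM⟩ := exists_not_isN_add V
      exact ⟨M, hM, hT.unique hS ▸ hM⟩
    · obtain ⟨X, hX⟩ := exists_isGameOf_of_finite ((hS.finite.image f).union (hT.finite.image g))
      have hXne : (f '' S ∪ g '' T).Nonempty := by
        rcases hne with ⟨x, hx | hx⟩
        · exact ⟨f x, Or.inl ⟨x, hx, rfl⟩⟩
        · exact ⟨g x, Or.inr ⟨x, hx, rfl⟩⟩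
      refine ⟨X, (hS.add hX).not_isN_iff.2 ⟨(hXne.image _).inr, ?_⟩,
        (hT.add hX).not_isN_iff.2 ⟨(hXne.image _).inr, ?_⟩⟩
      · rintro _ (⟨s, hs, rfl⟩ | ⟨_, ⟨s, hs, rfl⟩ | ⟨t, ht, rfl⟩, rfl⟩)
        · exact isN_add_of_right hX (Or.inl ⟨s, hs, rfl⟩) s (hf s hs)
        · exact isN_add_of_left hS hs _ (hf s hs)
        · exact hg' t ht
      · rintro _ (⟨t, ht, rfl⟩ | ⟨_, ⟨s, hs, rfl⟩ | ⟨t, ht, rfl⟩, rfl⟩)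
        · exact isN_add_of_right hX (Or.inr ⟨t, ht, rfl⟩) t (hg t ht)
        · exact hf' s hs
        · exact isN_add_of_left hT ht _ (hg t ht)

theorem IsGameOf.not_linked {S : Set Value} {V s : Value} (hS : IsGameOf S V) (hs : s ∈ S) :
    ¬ Linked V s := by
  obtain ⟨T, hT⟩ := exists_isGameOf s
  exact fun h => ((linked_iff hS hT).1 h).1 hs

/-- Two games are equal if neither is linked to an option of the other and, in case one of them has
no options, the other one is an N-position. -/
theorem eq_of_not_linked {S T : Set Value} {V W : Value} (hS : IsGameOf S V) (hT : IsGameOf T W)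
    (hST : ∀ t ∈ T, ¬ Linked V t) (hTS : ∀ s ∈ S, ¬ Linked W s) (hV : S = ∅ → W.IsN)
    (hW : T = ∅ → V.IsN) : V = W := by
  -- Suppose that `V + X` is a P-position. A winning move in `W + X` cannot go to some `t + X`,
  -- since then `X` links `V` to `t`; so it is a move in `X`, or there is no move at all and `X = 0`.
  have key : ∀ {T U : Set Value} {V W X : Value}, IsGameOf T W → IsGameOf U X →
      (∀ t ∈ T, ¬ Linked V t) → (T = ∅ → V.IsN) →
      (∀ u ∈ U, (V + u).IsN → (W + u).IsN) → (W + X).IsN → (V + X).IsN := by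
    intro T U V W X hT hU hST hW ih hWX
    by_contra hVX
    rcases (isN_add_iff hT hU).1 hWX with ⟨hTe, rfl⟩ | ⟨t, ht, h⟩ | ⟨u, hu, h⟩
    · rw [hU.unique isGameOf_zero, add_zero] at hVX
      exact hVX (hW hTe)
    · exact hST t ht ⟨X, hVX, h⟩
    · exact hVX (isN_add_of_right hU hu V fun h' => h (ih u hu h'))
  refine ext_isN fun X => ?_
  induction X using form_induction with
  | h U X hU ih =>
    exact ⟨key hS hU hTS hV fun u hu => (ih u hu).2, key hT hU hST hW fun u hu => (ih u hu).1⟩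

/-! ### Options of simplest forms -/

theorem _root_.Misere.Game.IsCanonical.options_eq {K : Game} (hK : K.IsCanonical) :
    K.value.options = {w | ∃ L ∈ K, L.value = w} := by
  -- An option `L` of `K` is not linked to `K`, hence not to the equal game `H`; and `H` is not
  -- equal to an option of `L`, so `L` is equal to an option of `H`.
  have key : ∀ {K H : Game}, K.IsCanonical → H.value = K.value → ∀ L ∈ K, ∃ M ∈ H,
      M.value = L.value := by
    intro K H hK hHK L hL
    have h := (isGameOf_value K).not_linked ⟨L, hL, rfl⟩
    rw [← hHK, linked_iff (isGameOf_value H) (isGameOf_value L), not_and_or, not_not, not_not] at h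
    refine h.resolve_right ?_
    rintro ⟨M, hM, hMH⟩
    cases hK with
    | intro _ _ hrev => exact hrev L hL M hM (value_eq_iff.1 (hMH.trans hHK))
  refine Set.ext fun w => ⟨?_, fun hw => ⟨K, hK, rfl, hw⟩⟩
  rintro ⟨H, hH, hHK, M, hM, rfl⟩
  exact key hH hHK.symm M hM

theorem isGameOf_options (V : Value) : IsGameOf V.options V := by
  obtain ⟨K, hK, rfl⟩ := exists_isCanonical V
  rw [hK.options_eq]
  exact isGameOf_value K

theorem finite_options (V : Value) : V.options.Finite := V.isGameOf_options.finite

theorem options_induction {p : Value → Prop} (h : ∀ V, (∀ v ∈ V.options, p v) → p V) (V : Value) :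
    p V := by
  have key : ∀ K : Game, K.IsCanonical → p K.value := by
    intro K hK
    induction hK with
    | intro K hopt hrev ih =>
      refine h _ ?_
      rw [(Game.IsCanonical.intro K hopt hrev).options_eq]
      rintro _ ⟨L, hL, rfl⟩
      exact ih L hL
  obtain ⟨K, hK, rfl⟩ := exists_isCanonical V
  exact key K hK

theorem wellFounded_options : WellFounded fun v V : Value => v ∈ V.options :=
  ⟨options_induction fun V h => ⟨V, h⟩⟩

theorem not_mem_options_of_mem {V W : Value} (h : W ∈ V.options) : V ∉ W.options :=
  fun h' => wellFounded_options.asymmetric _ _ h h'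

/-- An option of the simplest form does not reverse to the game, but it is not linked to the game
either; hence it occurs in every form. -/
theorem IsGameOf.options_subset {S : Set Value} {V : Value} (hS : IsGameOf S V) :
    V.options ⊆ S := by
  intro v hv
  have h := V.isGameOf_options.not_linked hv
  rw [linked_iff hS v.isGameOf_options, not_and_or, not_not, not_not] at h
  exact h.resolve_right (not_mem_options_of_mem hv)

theorem eq_zero_of_options_eq_empty {V : Value} (h : V.options = ∅) : V = 0 :=
  (h ▸ V.isGameOf_options).unique isGameOf_zero

theorem nonempty_options {V : Value} (h : V ≠ 0) : V.options.Nonempty :=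
  nonempty_iff_ne_empty.2 fun h' => h (eq_zero_of_options_eq_empty h')

/-- The options of a sum, taken from the simplest forms of its summands. -/
def sumOptions (V W : Value) : Set Value := (· + W) '' V.options ∪ (V + ·) '' W.options

theorem isGameOf_sumOptions (V W : Value) : IsGameOf (sumOptions V W) (V + W) :=
  V.isGameOf_options.add W.isGameOf_options

theorem not_linked_iff {S T : Set Value} {V W : Value} (hS : IsGameOf S V) (hT : IsGameOf T W) :
    ¬ Linked V W ↔ W ∈ S ∨ V ∈ T := by
  rw [linked_iff hS hT, not_and_or, not_not, not_not]

/-! ### The partitions of zero -/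

theorem isN_zero : (0 : Value).IsN := isGameOf_zero.isN_iff.2 (Or.inl rfl)

theorem not_isN_one : ¬ (1 : Value).IsN := by
  rw [isGameOf_one.not_isN_iff]
  exact ⟨singleton_nonempty _, fun s hs => (mem_singleton_iff.1 hs) ▸ isN_zero⟩

theorem isGameOf_one_add_one : IsGameOf {1} (1 + 1) := by
  have h := isGameOf_one.add isGameOf_one
  simpa using h

theorem one_add_one : (1 + 1 : Value) = 0 := by
  refine eq_of_not_linked isGameOf_one_add_one isGameOf_zero (fun t ht => ht.elim) ?_
    (fun h => (singleton_ne_empty _ h).elim)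
    fun _ => isGameOf_one_add_one.isN_iff.2 (Or.inr ⟨1, rfl, not_isN_one⟩)
  rintro _ rfl
  exact (not_linked_iff isGameOf_zero isGameOf_one).2 (Or.inr rfl)

theorem eq_one_of_one_add_eq_zero {X : Value} (h : 1 + X = 0) : X = 1 := by
  rw [← zero_add X, ← one_add_one, add_assoc, h, add_zero]

/-- The followers of a game are the games that are reached from it by one or more moves between
simplest forms. -/
def Follower (v V : Value) : Prop := Relation.TransGen (fun v V : Value => v ∈ V.options) v V

theorem Follower.of_mem {v V : Value} (h : v ∈ V.options) : Follower v V := .single h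

theorem Follower.trans {u v w : Value} (h : Follower u v) (h' : Follower v w) : Follower u w :=
  Relation.TransGen.trans h h'

theorem follower_induction {p : Value → Prop} (h : ∀ V, (∀ v, Follower v V → p v) → p V)
    (V : Value) : p V :=
  wellFounded_options.transGen.induction V h

theorem options_eq_pair {X : Value} (h0 : X ≠ 0) (h1 : X ≠ 1) (h : X.options ⊆ {0, 1}) :
    X.options = {0, 1} := by
  have hX := X.isGameOf_options
  rcases subset_pair_iff_eq.1 h with h | h | h | h
  · exact absurd (eq_zero_of_options_eq_empty h) h0
  · exact absurd ((h ▸ hX).unique isGameOf_one) h1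
  · exact absurd (((h ▸ hX).unique isGameOf_one_add_one).trans one_add_one) h0
  · exact h

/-- If neither `X` nor `Y` is `0` or `1`, every option of `X + Y` reverses to `0` through a smaller
partition of `0`, so that `X = Y = {0, 1}`; but `{0, 1} + {0, 1}` is a P-position. -/
theorem eq_zero_or_one_of_add_eq_zero {X Y : Value} (h : X + Y = 0) :
    (X = 0 ∧ Y = 0) ∨ (X = 1 ∧ Y = 1) := by
  induction X using follower_induction generalizing Y with
  | h X ihX =>
    induction Y using follower_induction with
    | h Y ihY =>
      by_cases hX0 : X = 0
      · rw [hX0, zero_add] at h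
        exact Or.inl ⟨hX0, h⟩
      by_cases hY0 : Y = 0
      · rw [hY0, add_zero] at h
        exact Or.inl ⟨h, hY0⟩
      by_cases hX1 : X = 1
      · exact Or.inr ⟨hX1, eq_one_of_one_add_eq_zero (hX1 ▸ h)⟩
      by_cases hY1 : Y = 1
      · exact Or.inr ⟨eq_one_of_one_add_eq_zero (by rw [add_comm, ← hY1, h]), hY1⟩
      exfalso
      have hrev : ∀ A B, A + B ∈ sumOptions X Y → (0 : Value) ∈ sumOptions A B := by
        intro A B hAB
        have hn := (isGameOf_sumOptions X Y).not_linked hAB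
        rw [h, not_linked_iff isGameOf_zero (isGameOf_sumOptions A B)] at hn
        exact hn.resolve_left id
      have hXs : X.options ⊆ {0, 1} := by
        intro x hx
        rcases hrev x Y (Or.inl ⟨x, hx, rfl⟩) with ⟨x', hx', hz⟩ | ⟨y, hy, hz⟩
        · rcases ihX x' ((Follower.of_mem hx').trans (.of_mem hx)) hz with h' | h'
          · exact absurd h'.2 hY0
          · exact absurd h'.2 hY1
        · exact (ihX x (.of_mem hx) hz).imp And.left And.left
      have hYs : Y.options ⊆ {0, 1} := by
        intro y hy
        rcases hrev X y (Or.inr ⟨y, hy, rfl⟩) with ⟨x, hx, hz⟩ | ⟨y', hy', hz⟩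
        · exact (ihX x (.of_mem hx) hz).imp And.right And.right
        · rcases ihY y' ((Follower.of_mem hy').trans (.of_mem hy)) hz with h' | h'
          · exact absurd h'.1 hX0
          · exact absurd h'.1 hX1
      have hX := X.isGameOf_options
      rw [options_eq_pair hX0 hX1 hXs] at hX
      have hY := Y.isGameOf_options
      rw [options_eq_pair hY0 hY1 hYs] at hY
      obtain rfl := hX.unique hY
      have hXN : X.IsN := hX.isN_iff.2 (Or.inr ⟨1, by simp, not_isN_one⟩)
      have hX1N : (1 + X).IsN :=
        isN_add_of_right hX (mem_insert 0 _) 1 (by rw [add_zero]; exact not_isN_one)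
      refine absurd isN_zero ?_
      rw [← h, (hX.add hX).not_isN_iff]
      refine ⟨⟨_, Or.inl ⟨0, by simp, rfl⟩⟩, ?_⟩
      rintro _ (⟨_, rfl | rfl, rfl⟩ | ⟨_, rfl | rfl, rfl⟩)
      · simpa using hXN
      · exact hX1N
      · simpa using hXN
      · simpa [add_comm X 1] using hX1N

theorem zero_eq_add_iff {X Y : Value} : 0 = X + Y ↔ (X = 0 ∧ Y = 0) ∨ (X = 1 ∧ Y = 1) := by
  refine ⟨fun h => eq_zero_or_one_of_add_eq_zero h.symm, ?_⟩
  rintro (⟨rfl, rfl⟩ | ⟨rfl, rfl⟩)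
  · exact (add_zero 0).symm
  · exact one_add_one.symm

/-! ### Cancellation -/

/-- `T` can be cancelled in equations `G + T = H + T`. -/
def Cancellable (T : Value) : Prop := ∀ G H : Value, G + T = H + T → G = H

/-- In each of the crossed equations `h + T = G + t` and `h + t = G + T`, one of the games `G + t`
and `h + t` is a side of the equation and the other one is an option of the other side. Hence these
two are not linked, and either `t` may be cancelled, or a crossed equation holds for `t` and an
option of `t`. -/
theorem not_linked_of_crossed {G h T t : Value} (hT : ∀ t, Follower t T → Cancellable t)
    (ht : t ∈ T.options) (hc : h + T = G + t ∨ h + t = G + T) : ¬ Linked G h := by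
  induction T using options_induction generalizing t with
  | h T ih =>
    have hn : ¬ Linked (G + t) (h + t) := by
      rcases hc with hc | hc
      · rw [← hc]
        exact (isGameOf_sumOptions h T).not_linked (Or.inr ⟨t, ht, rfl⟩)
      · rw [hc]
        exact fun hl => (isGameOf_sumOptions G T).not_linked (Or.inr ⟨t, ht, rfl⟩) hl.symm
    have htT := Follower.of_mem ht
    have ht' : ∀ u, Follower u t → Cancellable u := fun u hu => hT u (hu.trans htT)
    rw [not_linked_iff (isGameOf_sumOptions G t) (isGameOf_sumOptions h t)] at hn
    rcases hn with (⟨g, hg, e⟩ | ⟨u, hu, e⟩) | ⟨h', hh', e⟩ | ⟨u, hu, e⟩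
    · obtain rfl := hT t htT _ _ e
      exact G.isGameOf_options.not_linked hg
    · exact ih t ht ht' hu (Or.inl e.symm)
    · obtain rfl := hT t htT _ _ e
      exact fun hl => h.isGameOf_options.not_linked hh' hl.symm
    · exact ih t ht ht' hu (Or.inr e)

/-- The inductive step of the cancellation theorem, with the instances `h1` and `h2` of the
induction hypothesis. -/
theorem not_linked_of_add_eq_add {G H h T : Value} (hT : ∀ t, Follower t T → Cancellable t)
    (e : G + T = H + T) (hh : h ∈ H.options) (h1 : ∀ g ∈ G.options, g + T = h + T → g = h)
    (h2 : ∀ h' ∈ h.options, G + T = h' + T → G = h') : ¬ Linked G h := by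
  have hn : ¬ Linked (G + T) (h + T) := by
    rw [e]
    exact (isGameOf_sumOptions H T).not_linked (Or.inl ⟨h, hh, rfl⟩)
  rw [not_linked_iff (isGameOf_sumOptions G T) (isGameOf_sumOptions h T)] at hn
  rcases hn with (⟨g, hg, e'⟩ | ⟨t, ht, e'⟩) | ⟨h', hh', e'⟩ | ⟨t, ht, e'⟩
  · obtain rfl := h1 g hg e'
    exact G.isGameOf_options.not_linked hg
  · exact not_linked_of_crossed hT ht (Or.inl e'.symm)
  · obtain rfl := h2 h' hh' e'.symm
    exact fun hl => h.isGameOf_options.not_linked hh' hl.symm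
  · exact not_linked_of_crossed hT ht (Or.inr e')

/-- Either some option of `T` is `h + T`, absorbs `H` as `T` does, and may be cancelled; or each
option of `T` is `H` plus another one, and a cycle of these gives `k • H = 0` with `k > 0`. -/
theorem isN_of_add_eq_self {H T : Value} (hT : ∀ t ∈ T.options, Cancellable t) (e : H + T = T) :
    H.IsN := by
  by_cases hT0 : T = 0
  · rw [hT0, add_zero] at e
    exact e ▸ isN_zero
  have hsub : T.options ⊆ sumOptions H T :=
    IsGameOf.options_subset (Eq.subst (motive := IsGameOf _) e (isGameOf_sumOptions H T))
  by_cases hex : ∃ h ∈ H.options, h + T ∈ T.options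
  · obtain ⟨h, -, hh⟩ := hex
    have : H = 0 := hT _ hh H 0 (by rw [zero_add, add_left_comm, e])
    exact this ▸ isN_zero
  have hstep : ∀ t : T.options, ∃ u : T.options, H + u.1 = t.1 := by
    rintro ⟨t, ht⟩
    rcases hsub ht with ⟨h, hh, rfl⟩ | ⟨u, hu, hut⟩
    · exact absurd ⟨h, hh, ht⟩ hex
    · exact ⟨⟨u, hu⟩, hut⟩
  choose f hf using hstep
  obtain ⟨t, ht⟩ := nonempty_options hT0
  have : Finite T.options := T.finite_options
  obtain ⟨m, n, hne, hmn⟩ : ∃ m n, m ≠ n ∧ f^[m] ⟨t, ht⟩ = f^[n] ⟨t, ht⟩ := by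
    have := not_injective_infinite_finite fun n : ℕ => f^[n] ⟨t, ht⟩
    simp only [Function.Injective] at this
    push Not at this
    obtain ⟨m, n, h, h'⟩ := this
    exact ⟨m, n, h', h⟩
  have hiter : ∀ (k : ℕ) (u : T.options), k • H + (f^[k] u).1 = u.1 := by
    intro k
    induction k with
    | zero => intro u; simp
    | succ k ih => intro u; rw [Function.iterate_succ_apply, succ_nsmul', add_assoc, ih, hf]
  have hcyc : ∀ (m k : ℕ), f^[m] ⟨t, ht⟩ = f^[m + (k + 1)] ⟨t, ht⟩ → H.IsN := by
    intro m k hk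
    have h1 := hiter (k + 1) (f^[m] ⟨t, ht⟩)
    rw [← Function.iterate_add_apply, add_comm (k + 1) m, ← hk] at h1
    have h2 : (k + 1) • H = 0 := hT _ (f^[m] ⟨t, ht⟩).2 _ _ (by rw [h1, zero_add])
    rw [succ_nsmul'] at h2
    rcases eq_zero_or_one_of_add_eq_zero h2 with ⟨h0, -⟩ | ⟨h0, -⟩
    · exact h0 ▸ isN_zero
    · -- `1 + T = T` is impossible, since `1 + (T + M)` has the option `T + M`.
      obtain ⟨M, hM⟩ := exists_not_isN_add T
      refine absurd ?_ hM
      rw [← e, h0, add_assoc]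
      exact isN_add_of_left isGameOf_one rfl _ (by rwa [zero_add])
  rcases lt_or_gt_of_ne hne with h | h
  · obtain ⟨k, rfl⟩ := Nat.exists_eq_add_of_lt h
    exact hcyc m k hmn
  · obtain ⟨k, rfl⟩ := Nat.exists_eq_add_of_lt h
    exact hcyc n k hmn.symm

theorem cancellable (T : Value) : Cancellable T := by
  induction T using follower_induction with
  | h T hT =>
    intro G H e
    induction G using follower_induction generalizing H with
    | h G ihG =>
      induction H using follower_induction with
      | h H ihH =>
        have hT' : ∀ t ∈ T.options, Cancellable t := fun t ht => hT t (.of_mem ht)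
        refine eq_of_not_linked G.isGameOf_options H.isGameOf_options ?_ ?_ ?_ ?_
        · intro h hh
          exact not_linked_of_add_eq_add hT e hh (fun g hg e' => ihG g (.of_mem hg) h e')
            fun h' hh' e' => ihH h' ((Follower.of_mem hh').trans (.of_mem hh)) e'
        · intro g hg
          exact not_linked_of_add_eq_add hT e.symm hg
            (fun h hh e' => (ihG g (.of_mem hg) h e'.symm).symm)
            fun g' hg' e' => (ihG g' ((Follower.of_mem hg').trans (.of_mem hg)) H e'.symm).symm
        · intro h0
          refine isN_of_add_eq_self hT' ?_
          rw [← e, eq_zero_of_options_eq_empty h0, zero_add]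
        · intro h0
          refine isN_of_add_eq_self hT' ?_
          rw [e, eq_zero_of_options_eq_empty h0, zero_add]

instance : IsCancelAdd Value where
  add_right_cancel T G H e := cancellable T G H e
  add_left_cancel T G H e := cancellable T G H (by rwa [add_comm G, add_comm H])

end Value

open Value

/-! ### Partitions of a game and of its options -/

namespace Value

theorem options_subset_sumOptions {G X Y : Value} (h : G = X + Y) :
    G.options ⊆ sumOptions X Y := by
  rw [h]
  exact (isGameOf_sumOptions X Y).options_subset

/-- If `x + Y` is not an option of `G = X + Y`, it reverses to `G`. By cancellation it cannot do so
through a move in `x`. -/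
theorem mem_options_or_exists_eq_add {G X Y x : Value} (h : G = X + Y) (hx : x ∈ X.options) :
    x + Y ∈ G.options ∨ ∃ y ∈ Y.options, G = x + y := by
  have hn : ¬ Linked G (x + Y) := by
    rw [h]
    exact (isGameOf_sumOptions X Y).not_linked (Or.inl ⟨x, hx, rfl⟩)
  rw [not_linked_iff G.isGameOf_options (isGameOf_sumOptions x Y)] at hn
  rcases hn with hn | ⟨x', hx', e⟩ | ⟨y, hy, e⟩
  · exact Or.inl hn
  · obtain rfl : x' = X := add_right_cancel (e.trans h)
    exact absurd hx' (not_mem_options_of_mem hx)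
  · exact Or.inr ⟨y, hy, e.symm⟩

end Value

/-- `P` lists exactly the pairs `(X, Y)` with `G = X + Y`. -/
def IsPartitionTable (G : Value) (P : Table) : Prop := ∀ X Y, (X, Y) ∈ P ↔ G = X + Y

/-- `tabs` consists of the partition tables of the options of `G`. -/
structure IsOptionTables (G : Value) (tabs : List Table) : Prop where
  exists_option : ∀ T ∈ tabs, ∃ g ∈ G.options, IsPartitionTable g T
  exists_table : ∀ g ∈ G.options, ∃ T ∈ tabs, IsPartitionTable g T

theorem isPartitionTable_zero : IsPartitionTable 0 Table.zero := fun X Y => by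
  rw [zero_eq_add_iff]
  simp [Table.zero]

theorem Table.mem_record {T : Table} {X Y A B : Value} :
    (A, B) ∈ T.record X Y ↔ (A, B) ∈ T ∨ (A = X ∧ B = Y) ∨ (A = Y ∧ B = X) := by
  simp only [Table.record, Finset.mem_union, Finset.mem_insert, Finset.mem_singleton,
    Prod.mk.injEq]

/-! ### Finiteness of the loops -/

theorem Table.finite_setOf_mem_right (T : Table) (X : Value) : {Y | (X, Y) ∈ T}.Finite :=
  (T.finite_toSet.image Prod.snd).subset fun Y hY => ⟨(X, Y), hY, rfl⟩

theorem finite_candidates (tabs : List Table) : (candidates tabs).Finite := by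
  refine (tabs.finite_toSet.biUnion fun T _ => T.finite_toSet.image Prod.fst).subset ?_
  rintro X ⟨T, hT, Y, hY⟩
  exact mem_biUnion hT ⟨(X, Y), hY, rfl⟩

theorem finite_differencesAt (T : Table) (X : Value) : (differencesAt T X).Finite :=
  (X.finite_options.biUnion fun x _ => T.finite_setOf_mem_right x).subset
    fun _ ⟨_, hx, hz⟩ => mem_biUnion hx hz

theorem finite_differencesOf (tabs : List Table) (x : Value) : (differencesOf tabs x).Finite :=
  (tabs.finite_toSet.biUnion fun T _ => T.finite_setOf_mem_right x).subset
    fun _ ⟨_, hT, hz⟩ => mem_biUnion hT hz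

theorem finite_novelOptions (tabs : List Table) (R : Table) (X : Value) :
    (novelOptions tabs R X).Finite :=
  (finite_differencesAt R X).union (finite_differencesOf tabs X)

theorem exists_enumerates {α : Type} {S : Set α} (hS : S.Finite) : ∃ l, Enumerates l S :=
  ⟨hS.toFinset.toList, hS.toFinset.nodup_toList, by simp⟩

namespace IsOptionTables

variable {G : Value} {tabs : List Table}

theorem mem_candidates_or (h : IsOptionTables G tabs) (hG : G ≠ 0) {X Y : Value}
    (e : G = X + Y) : X ∈ candidates tabs ∨ Y ∈ candidates tabs := by
  obtain ⟨g, hg⟩ := nonempty_options hG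
  obtain ⟨T, hT, hgT⟩ := h.exists_table g hg
  rcases options_subset_sumOptions e hg with ⟨x, -, e'⟩ | ⟨y, -, e'⟩
  · exact Or.inr ⟨T, hT, x, (hgT _ _).2 (e'.symm.trans (add_comm _ _))⟩
  · exact Or.inl ⟨T, hT, y, (hgT _ _).2 e'.symm⟩

/-- One summand is a candidate, and it determines the other one by cancellation. -/
theorem finite_partitions (h : IsOptionTables G tabs) (hG : G ≠ 0) :
    {p : Value × Value | G = p.1 + p.2}.Finite := by
  have h1 : {p : Value × Value | G = p.1 + p.2 ∧ p.1 ∈ candidates tabs}.Finite := by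
    refine Set.Finite.of_finite_image (f := Prod.fst)
      ((finite_candidates tabs).subset (image_subset_iff.2 fun p hp => hp.2)) ?_
    rintro ⟨a, b⟩ ⟨hp, -⟩ ⟨c, d⟩ ⟨hq, -⟩ (rfl : a = c)
    obtain rfl : b = d := add_left_cancel (hp.symm.trans hq : a + b = a + d)
    rfl
  refine (h1.union (h1.image Prod.swap)).subset ?_
  rintro ⟨a, b⟩ (hp : G = a + b)
  rcases h.mem_candidates_or hG hp with hc | hc
  · exact Or.inl ⟨hp, hc⟩
  · exact Or.inr ⟨(b, a), ⟨hp.trans (add_comm _ _), hc⟩, rfl⟩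

/-! ### Soundness of the tests -/

/-- The options `X + (G - x)` and `x + Y` of `X + Y` reverse to `G = x + (G - x)`, and the options
`X + (g - X)` are the options `g` of `G`. -/
theorem eq_add_of_novelTest (h : IsOptionTables G tabs) (hG : G ≠ 0) {R : Table}
    (hR : ∀ X Y, (X, Y) ∈ R → G = X + Y) {X Y : Value} (ht : NovelTest tabs R X)
    (hY : IsGameOf (novelOptions tabs R X) Y) : G = X + Y := by
  have hopt : ∀ g ∈ G.options, g ∈ (X + ·) '' novelOptions tabs R X := by
    intro g hg
    obtain ⟨T, hT, hgT⟩ := h.exists_table g hg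
    obtain ⟨z, hz⟩ := ht.1 T hT
    exact ⟨z, Or.inr ⟨T, hT, hz⟩, ((hgT _ _).1 hz).symm⟩
  have hS := X.isGameOf_options.add hY
  obtain ⟨g, hg⟩ := nonempty_options hG
  refine eq_of_not_linked G.isGameOf_options hS ?_ ?_
    (fun he => absurd hg (he ▸ notMem_empty g))
    (fun he => absurd (Or.inr (hopt g hg)) (eq_empty_iff_forall_notMem.1 he g))
  · rintro _ (⟨x, hx, rfl⟩ | ⟨z, ⟨x, hx, hz⟩ | ⟨T, hT, hz⟩, rfl⟩)
    · rw [not_linked_iff G.isGameOf_options (x.isGameOf_options.add hY)]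
      obtain ⟨z, hz⟩ := ht.2 x hx
      exact Or.inr (Or.inr ⟨z, Or.inl ⟨x, hx, hz⟩, (hR _ _ hz).symm⟩)
    · rw [not_linked_iff G.isGameOf_options (isGameOf_sumOptions X z)]
      exact Or.inr (Or.inl ⟨x, hx, (hR _ _ hz).symm⟩)
    · obtain ⟨g, hg, hgT⟩ := h.exists_option T hT
      exact G.isGameOf_options.not_linked (((hgT _ _).1 hz).symm ▸ hg : X + z ∈ G.options)
  · exact fun g hg => hS.not_linked (Or.inr (hopt g hg))

theorem eq_add_of_derivedTest (h : IsOptionTables G tabs) (hG : G ≠ 0) {R : Table}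
    (hR : ∀ X Y, (X, Y) ∈ R → G = X + Y) {X Y : Value} (ht : DerivedTest tabs R X Y) :
    G = X + Y := by
  obtain ⟨h1, h2, h3⟩ := ht
  have hopt : ∀ g ∈ G.options, g ∈ sumOptions X Y := by
    intro g hg
    obtain ⟨T, hT, hgT⟩ := h.exists_table g hg
    rcases h1 T hT with ⟨x, hx, hz⟩ | ⟨y, hy, hz⟩
    · exact Or.inl ⟨x, hx, (add_comm _ _).trans ((hgT _ _).1 hz).symm⟩
    · exact Or.inr ⟨y, hy, ((hgT _ _).1 hz).symm⟩
  have hS := isGameOf_sumOptions X Y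
  obtain ⟨g, hg⟩ := nonempty_options hG
  refine eq_of_not_linked G.isGameOf_options hS ?_ ?_
    (fun he => absurd hg (he ▸ notMem_empty g))
    (fun he => absurd (hopt g hg) (eq_empty_iff_forall_notMem.1 he g))
  · rintro _ (⟨x, hx, rfl⟩ | ⟨y, hy, rfl⟩)
    · rw [not_linked_iff G.isGameOf_options (isGameOf_sumOptions x Y)]
      rcases h2 x hx with ⟨T, hT, hz⟩ | ⟨y, hy, hz⟩
      · obtain ⟨g, hg, hgT⟩ := h.exists_option T hT
        exact Or.inl (((hgT _ _).1 hz).trans (add_comm _ _) ▸ hg)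
      · exact Or.inr (Or.inr ⟨y, hy, (hR _ _ hz).symm⟩)
    · rw [not_linked_iff G.isGameOf_options (isGameOf_sumOptions X y)]
      rcases h3 y hy with ⟨T, hT, hz⟩ | ⟨x, hx, hz⟩
      · obtain ⟨g, hg, hgT⟩ := h.exists_option T hT
        exact Or.inl ((hgT _ _).1 hz ▸ hg)
      · exact Or.inr (Or.inl ⟨x, hx, (hR _ _ hz).symm⟩)
  · exact fun g hg => hS.not_linked (hopt g hg)

end IsOptionTables

/-! ### Completeness of the tests -/

/-- The record `R` contains all partitions of `G` into an option of `X` and an option of `Y`. -/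
def HasSmaller (G : Value) (R : Table) (X Y : Value) : Prop :=
  ∀ x ∈ X.options, ∀ y ∈ Y.options, G = x + y → (x, y) ∈ R

namespace IsOptionTables

variable {G : Value} {tabs : List Table}

theorem derivedTest (h : IsOptionTables G tabs) {R : Table} {X Y : Value} (e : G = X + Y)
    (hs : HasSmaller G R X Y) : DerivedTest tabs R X Y := by
  refine ⟨fun T hT => ?_, fun x hx => ?_, fun y hy => ?_⟩
  · obtain ⟨g, hg, hgT⟩ := h.exists_option T hT
    rcases options_subset_sumOptions e hg with ⟨x, hx, e'⟩ | ⟨y, hy, e'⟩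
    · exact Or.inl ⟨x, hx, (hgT _ _).2 (e'.symm.trans (add_comm _ _))⟩
    · exact Or.inr ⟨y, hy, (hgT _ _).2 e'.symm⟩
  · rcases mem_options_or_exists_eq_add e hx with hg | ⟨y, hy, e'⟩
    · obtain ⟨T, hT, hgT⟩ := h.exists_table _ hg
      exact Or.inl ⟨T, hT, (hgT _ _).2 (add_comm _ _)⟩
    · exact Or.inr ⟨y, hy, hs x hx y hy e'⟩
  · rcases mem_options_or_exists_eq_add (e.trans (add_comm _ _)) hy with hg | ⟨x, hx, e'⟩
    · obtain ⟨T, hT, hgT⟩ := h.exists_table _ hg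
      exact Or.inl ⟨T, hT, (hgT _ _).2 (add_comm _ _)⟩
    · exact Or.inr ⟨x, hx, hs x hx y hy (e'.trans (add_comm _ _))⟩

theorem mem_differencesAt (h : IsOptionTables G tabs) {T : Table} (hT : T ∈ tabs) {X Y : Value}
    (hX : ¬ T.Has X) (e : G = X + Y) : Y ∈ differencesAt T X := by
  obtain ⟨g, hg, hgT⟩ := h.exists_option T hT
  rcases options_subset_sumOptions e hg with ⟨x, hx, e'⟩ | ⟨y, -, e'⟩
  · exact ⟨x, hx, (hgT _ _).2 e'.symm⟩
  · exact absurd ⟨y, (hgT _ _).2 e'.symm⟩ hX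

theorem mem_differencesOf (h : IsOptionTables G tabs) {R : Table} {X Y x : Value}
    (hx : x ∈ X.options) (hR : ¬ R.Has x) (e : G = X + Y) (hs : HasSmaller G R X Y) :
    Y ∈ differencesOf tabs x := by
  rcases mem_options_or_exists_eq_add e hx with hg | ⟨y, hy, e'⟩
  · obtain ⟨T, hT, hgT⟩ := h.exists_table _ hg
    exact ⟨T, hT, (hgT _ _).2 rfl⟩
  · exact absurd ⟨y, hs x hx y hy e'⟩ hR

end IsOptionTables

/-- `R` contains every partition of `G` with first summand `X` whose smaller partitions it
contains. This is what a pass of the main loop that leaves `R` unchanged establishes for the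
candidates `X` it has treated. -/
def IsSettled (G : Value) (R : Table) (X : Value) : Prop :=
  ∀ Y, G = X + Y → HasSmaller G R X Y → (X, Y) ∈ R

/-- The properties of a record for `G` that all steps preserve. -/
structure IsRecord (G : Value) (R : Table) : Prop where
  sound : ∀ X Y, (X, Y) ∈ R → G = X + Y
  symm : ∀ X Y, (X, Y) ∈ R → (Y, X) ∈ R

theorem IsRecord.record {G : Value} {R : Table} (h : IsRecord G R) {X Y : Value} (e : G = X + Y) :
    IsRecord G (R.record X Y) where
  sound A B hAB := by
    rcases Table.mem_record.1 hAB with h' | ⟨rfl, rfl⟩ | ⟨rfl, rfl⟩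
    · exact h.sound _ _ h'
    · exact e
    · exact e.trans (add_comm _ _)
  symm A B hAB := by
    rcases Table.mem_record.1 hAB with h' | h' | h'
    · exact Table.mem_record.2 (Or.inl (h.symm _ _ h'))
    · exact Table.mem_record.2 (Or.inr (Or.inr h'.symm))
    · exact Table.mem_record.2 (Or.inr (Or.inl h'.symm))

theorem Table.subset_record (R : Table) (X Y : Value) : R ⊆ R.record X Y :=
  fun _ hp => Table.mem_record.2 (Or.inl hp)

/-- If all candidates are settled, all partitions are recorded, by induction on the first
summand. -/
theorem IsRecord.isPartitionTable {G : Value} {tabs : List Table} {R : Table} (hR : IsRecord G R)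
    (h : IsOptionTables G tabs) (hG : G ≠ 0) (hs : ∀ X ∈ candidates tabs, IsSettled G R X) :
    IsPartitionTable G R := by
  refine fun X Y => ⟨hR.sound X Y, fun e => ?_⟩
  induction X using options_induction generalizing Y with
  | h X ih =>
    rcases h.mem_candidates_or hG e with hc | hc
    · exact hs X hc Y e fun x hx y _ e' => ih x hx y e'
    · refine hR.symm _ _ (hs Y hc X (e.trans (add_comm _ _)) fun y _ x hx e' => ?_)
      exact hR.symm _ _ (ih x hx y (e'.trans (add_comm _ _)))

/-! ### Executions of the algorithm -/

/-- Every execution from the given state terminates, and only in states that satisfy `Φ`. -/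
inductive Settles (Φ : State → Prop) : State → Prop
  | intro (s : State) (hstep : ∀ t, Step s t → Settles Φ t) (hfinal : (∀ t, ¬ Step s t) → Φ s) :
      Settles Φ s

namespace Settles

variable {Φ : State → Prop}

theorem of_exists {s : State} (hstep : ∀ t, Step s t → Settles Φ t) (h : ∃ t, Step s t) :
    Settles Φ s :=
  .intro s hstep fun hfinal => let ⟨t, ht⟩ := h; absurd ht (hfinal t)

theorem not_exists_infinite {s : State} (h : Settles Φ s) :
    ¬ ∃ f : ℕ → State, f 0 = s ∧ ∀ k, Step (f k) (f (k + 1)) := by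
  induction h with
  | intro s _ _ ih =>
    rintro ⟨f, rfl, hf⟩
    exact ih (f 1) (hf 0) ⟨fun k => f (k + 1), rfl, fun k => hf (k + 1)⟩

theorem of_terminal {s t : State} (h : Settles Φ s) (hst : Relation.ReflTransGen Step s t)
    (ht : ∀ u, ¬ Step t u) : Φ t := by
  induction h with
  | intro s _ hfinal ih =>
    rcases hst.cases_head with rfl | ⟨u, hu, hut⟩
    · exact hfinal ht
    · exact ih u hu hut

variable {G : Value} {tabs : List Table} {st : List Frame} {R₀ : Table} {todo : List Value}

/-- The inner loop for `X`: unless the record changes, it settles `X`, provided that each `Y` for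
which the pair `X`, `Y` is missing is still to be treated. The record `R₁` at the start of the inner
loop may be larger than the record `R₀` at the start of the pass. -/
theorem test (h : IsOptionTables G tabs) (hG : G ≠ 0) {X : Value}
    {R₁ : Table} (h01 : R₀ ⊆ R₁)
    (hnext : ∀ R, R₁ ⊆ R → IsRecord G R → (R = R₀ → IsSettled G R₀ X) →
      Settles Φ (.scan tabs R₀ R todo st))
    (ys : List Value) (R : Table) (hsub : R₁ ⊆ R) (hR : IsRecord G R)
    (hys : R = R₀ → ∀ Y, G = X + Y → HasSmaller G R₀ X Y → (X, Y) ∈ R₀ ∨ Y ∈ ys) :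
    Settles Φ (.test tabs R₀ R todo X ys st) := by
  induction ys generalizing R with
  | nil =>
    refine of_exists (fun t ht => ?_) ⟨_, .next ..⟩
    cases ht
    exact hnext R hsub hR fun e Y hY hs => (hys e Y hY hs).resolve_right (by simp)
  | cons Y ys ih =>
    refine of_exists (fun t ht => ?_) ?_
    · cases ht with
      | accept _ _ _ _ _ _ _ _ hd =>
        refine ih _ (hsub.trans (R.subset_record X Y))
          (hR.record (h.eq_add_of_derivedTest hG hR.sound hd)) fun e Z hZ hs => ?_
        have e' : R = R₀ := ((R.subset_record X Y).trans_eq e).antisymm (h01.trans hsub)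
        rcases hys e' Z hZ hs with hm | hm
        · exact Or.inl hm
        rcases List.mem_cons.1 hm with rfl | hm
        · exact Or.inl (e ▸ Table.mem_record.2 (Or.inr (Or.inl ⟨rfl, rfl⟩)))
        · exact Or.inr hm
      | reject _ _ _ _ _ _ _ _ hd =>
        refine ih R hsub hR fun e Z hZ hs => ?_
        rcases hys e Z hZ hs with hm | hm
        · exact Or.inl hm
        rcases List.mem_cons.1 hm with rfl | hm
        · subst e
          exact absurd (h.derivedTest hZ hs) hd
        · exact Or.inr hm
    · by_cases hd : DerivedTest tabs R X Y
      · exact ⟨_, .accept _ _ _ _ _ _ _ _ hd⟩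
      · exact ⟨_, .reject _ _ _ _ _ _ _ _ hd⟩

/-- One pass of the main loop. -/
theorem pass (h : IsOptionTables G tabs) (hG : G ≠ 0)
    (hend : ∀ R, R₀ ⊆ R → IsRecord G R →
      (R = R₀ → ∀ X ∈ candidates tabs, IsSettled G R₀ X) → Settles Φ (.scan tabs R₀ R [] st))
    (todo : List Value) (R : Table) (hsub : R₀ ⊆ R) (hR : IsRecord G R)
    (htodo : R = R₀ → ∀ X ∈ candidates tabs, X ∈ todo ∨ IsSettled G R₀ X) :
    Settles Φ (.scan tabs R₀ R todo st) := by
  induction todo generalizing R with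
  | nil => exact hend R hsub hR fun e X hX => (htodo e X hX).resolve_left (by simp)
  | cons X todo ih =>
    have hnext : ∀ R', R ⊆ R' → IsRecord G R' → (R' = R₀ → IsSettled G R₀ X) →
        Settles Φ (.scan tabs R₀ R' todo st) := by
      refine fun R' hRR' hR' hX => ih R' (hsub.trans hRR') hR' fun e Z hZ => ?_
      have e' : R = R₀ := (hRR'.trans_eq e).antisymm hsub
      rcases htodo e' Z hZ with hm | hm
      · rcases List.mem_cons.1 hm with rfl | hm
        · exact Or.inr (hX e)
        · exact Or.inl hm
      · exact Or.inr hm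
    have htest : ∀ ys : List Value,
        (R = R₀ → ∀ Y, G = X + Y → HasSmaller G R₀ X Y → Y ∈ ys) →
        Settles Φ (.test tabs R₀ R todo X ys st) := fun ys hys =>
      test h hG hsub hnext ys R Subset.rfl hR fun e Y hY hs => Or.inr (hys e Y hY hs)
    refine of_exists (fun t ht => ?_) ?_
    · cases ht with
      | novel _ _ _ _ Y _ _ hX hY =>
        have e := h.eq_add_of_novelTest hG hR.sound hX hY
        refine hnext _ (R.subset_record X Y) (hR.record e) fun e' Z hZ _ => ?_
        obtain rfl : Y = Z := add_left_cancel (e.symm.trans hZ)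
        exact e' ▸ Table.mem_record.2 (Or.inr (Or.inl ⟨rfl, rfl⟩))
      | fixOption _ _ _ _ _ _ T hT hX ys hl =>
        exact htest ys fun _ Y hY _ => (hl.2 Y).2 (h.mem_differencesAt hT hX hY)
      | fixPart _ _ _ _ _ _ _ x hx hRx ys hl =>
        refine htest ys fun e Y hY hs => (hl.2 Y).2 ?_
        subst e
        exact h.mem_differencesOf hx hRx hY hs
    · by_cases h1 : ∀ T ∈ tabs, T.Has X
      · by_cases h2 : ∀ x ∈ X.options, R.Has x
        · obtain ⟨Y, hY⟩ := exists_isGameOf_of_finite (finite_novelOptions tabs R X)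
          exact ⟨_, .novel _ _ _ _ Y _ _ ⟨h1, h2⟩ hY⟩
        · push Not at h2
          obtain ⟨x, hx, hRx⟩ := h2
          obtain ⟨ys, hl⟩ := exists_enumerates (finite_differencesOf tabs x)
          exact ⟨_, .fixPart _ _ _ _ _ _ h1 x hx hRx ys hl⟩
      · push Not at h1
        obtain ⟨T, hT, hX⟩ := h1
        obtain ⟨ys, hl⟩ := exists_enumerates (finite_differencesAt T X)
        exact ⟨_, .fixOption _ _ _ _ _ _ T hT hX ys hl⟩

/-- The main loop: each pass that is not the last one enlarges the record, which is a subset of the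
finite set of all partitions of `G`. -/
theorem scan (h : IsOptionTables G tabs) (hG : G ≠ 0)
    (hret : ∀ P, IsPartitionTable G P → Settles Φ (.ret P st)) (hR₀ : IsRecord G R₀)
    (hl : Enumerates todo (candidates tabs)) : Settles Φ (.scan tabs R₀ R₀ todo st) := by
  classical
  induction hn : ((h.finite_partitions hG).toFinset \ R₀).card using Nat.strong_induction_on
    generalizing R₀ todo with
  | h n ih =>
    refine pass h hG (fun R hsub hR hs => ?_) todo R₀ Subset.rfl hR₀
      fun _ X hX => Or.inl ((hl.2 X).2 hX)
    refine of_exists (fun t ht => ?_) ?_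
    · cases ht with
      | again _ _ _ _ _ hne hl =>
        refine ih _ ?_ hR hl rfl
        rw [← hn]
        obtain ⟨p, hp, hp'⟩ := Finset.exists_of_ssubset (hsub.ssubset_of_ne hne.symm)
        refine Finset.card_lt_card (Finset.ssubset_iff_of_subset
          (Finset.sdiff_subset_sdiff Subset.rfl hsub) |>.2 ⟨p, ?_, ?_⟩)
        · exact Finset.mem_sdiff.2
            ⟨(h.finite_partitions hG).mem_toFinset.2 (hR.sound p.1 p.2 hp), hp'⟩
        · exact fun hm => (Finset.mem_sdiff.1 hm).2 hp
      | finish => exact hret _ (hR.isPartitionTable h hG (hs rfl))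
    · by_cases hne : R = R₀
      · subst hne
        exact ⟨_, .finish ..⟩
      · obtain ⟨l, hl⟩ := exists_enumerates (finite_candidates tabs)
        exact ⟨_, .again _ _ _ _ _ hne hl⟩

/-- The loop of the recursive calls, for calls that return the correct tables. -/
theorem collect (hG : G ≠ 0)
    (hcall : ∀ g ∈ G.options, ∀ st, (∀ P, IsPartitionTable g P → Settles Φ (.ret P st)) →
      Settles Φ (.call g st))
    (hret : ∀ P, IsPartitionTable G P → Settles Φ (.ret P st)) (pending : List Value)
    (hpending : ∀ g ∈ pending, g ∈ G.options)
    (htabs : ∀ T ∈ tabs, ∃ g ∈ G.options, IsPartitionTable g T)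
    (hopt : ∀ g ∈ G.options, g ∈ pending ∨ ∃ T ∈ tabs, IsPartitionTable g T) :
    Settles Φ (.collect pending tabs st) := by
  induction pending generalizing tabs with
  | nil =>
    have h : IsOptionTables G tabs := ⟨htabs, fun g hg => (hopt g hg).resolve_left (by simp)⟩
    refine of_exists (fun t ht => ?_) ?_
    · cases ht with
      | start _ todo _ hl => exact scan h hG hret ⟨by simp, by simp⟩ hl
    · obtain ⟨l, hl⟩ := exists_enumerates (finite_candidates tabs)
      exact ⟨_, .start _ _ _ hl⟩
  | cons g pending ih =>
    have hg := hpending g List.mem_cons_self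
    refine of_exists (fun t ht => ?_) ⟨_, .recurse ..⟩
    cases ht
    refine hcall g hg _ fun P hP => of_exists (fun t ht => ?_) ⟨_, .resume ..⟩
    cases ht
    refine ih (fun k hk => hpending k (List.mem_cons_of_mem _ hk)) ?_ fun k hk => ?_
    · rintro T hT
      rcases List.mem_cons.1 hT with rfl | hT
      · exact ⟨g, hg, hP⟩
      · exact htabs T hT
    · rcases hopt k hk with hm | ⟨T, hT, hkT⟩
      · rcases List.mem_cons.1 hm with rfl | hm
        · exact Or.inr ⟨P, List.mem_cons_self, hP⟩
        · exact Or.inl hm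
      · exact Or.inr ⟨T, List.mem_cons_of_mem _ hT, hkT⟩

theorem call (G : Value) (st : List Frame)
    (hret : ∀ P, IsPartitionTable G P → Settles Φ (.ret P st)) : Settles Φ (.call G st) := by
  induction G using options_induction generalizing st with
  | h G ih =>
    by_cases hG : G = 0
    · subst hG
      refine of_exists (fun t ht => ?_) ⟨_, .base st⟩
      cases ht with
      | base => exact hret _ isPartitionTable_zero
      | enter _ _ _ h0 _ => exact absurd rfl h0
    · refine of_exists (fun t ht => ?_) ?_
      · cases ht with
        | base => exact absurd rfl hG
        | enter _ pending _ _ hl =>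
          exact collect hG ih hret pending (fun g hg => (hl.2 g).1 hg) (by simp)
            fun g hg => Or.inl ((hl.2 g).2 hg)
      · obtain ⟨l, hl⟩ := exists_enumerates G.finite_options
        exact ⟨_, .enter _ _ _ hG hl⟩

end Settles

end Misere

theorem mainTheorem12 (G : Misere.Game) :
    (¬ ∃ s : ℕ → Misere.State,
      s 0 = Misere.State.call G.value [] ∧ ∀ k, Misere.Step (s k) (s (k + 1))) ∧
    ∀ s : Misere.State,
      Relation.ReflTransGen Misere.Step (Misere.State.call G.value []) s →
      (∀ t, ¬ Misere.Step s t) →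
      ∃ P : Misere.Table, s = Misere.State.ret P [] ∧
        {X | P.Has X} = Misere.Value.parts G.value ∧
        (∀ X Y, (X, Y) ∈ P ↔ G.value = X + Y) ∧
        ∀ X ∈ Misere.Value.parts G.value, ∃! Y, (X, Y) ∈ P := by
  have h := Misere.Settles.call
    (Φ := fun s => ∃ P, s = .ret P [] ∧ Misere.IsPartitionTable G.value P) G.value []
    fun P hP => .intro _ (fun t ht => nomatch ht) fun _ => ⟨P, rfl, hP⟩
  refine ⟨h.not_exists_infinite, fun s hs hfinal => ?_⟩
  obtain ⟨P, rfl, hP⟩ := h.of_terminal hs hfinal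
  refine ⟨P, rfl, Set.ext fun X => exists_congr fun Y => hP X Y, hP, ?_⟩
  rintro X ⟨Y, hY⟩
  exact ⟨Y, (hP X Y).2 hY, fun Z hZ => add_left_cancel (((hP X Z).1 hZ).symm.trans hY)⟩
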